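/- There is a universal constant $C>0$ such that the following holds. Let $n\ge 2$ and $s\ge 0$ be integers, let $A_1,\ldots,A_s$ be (nonrandom) real symmetric $n\times n$ matrices, let $g_1,\ldots,g_s$ be independent standard Gaussian random variables, and let $X=\sum_{k=1}^s g_kA_k$. Denote by $\|\cdot\|$ the spectral norm (largest singular value), and define $$ \sigma := \Big\|\sum_{k=1}^s A_k^2\Big\|^{1/2},\qquad \tilde\sigma := \sup_{U_1,U_2,U_3}\Big\|\sum_{k,l=1}^s A_kU_1A_lU_2A_kU_3A_l\Big\|^{1/4}, $$ where the supremum is taken over all triples $U_1,U_2,U_3$ of pairwise commuting complex unitary $n\times n$ matrices. Then $\mathbf{E}\|X\|<\infty$ and $$ \mathbf{E}\|X\|\le C\big(\sigma\,(\log n)^{1/4}+\tilde\sigma\,(\log n)^{1/2}\big). $$ -/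

import Mathlib

open MeasureTheory ProbabilityTheory
open scoped Matrix.Norms.L2Operator

namespace StructuredRandomMatrix

noncomputable section

/-- The Gaussian matrix `X = ∑ₖ gₖ Aₖ`, with real coefficient matrices `Aₖ`. -/
def gaussianSeries {Ω : Type*} {n s : ℕ} (A : Fin s → Matrix (Fin n) (Fin n) ℝ)
    (g : Fin s → Ω → ℝ) (ω : Ω) : Matrix (Fin n) (Fin n) ℝ :=
  ∑ k, g k ω • A k

/-- The parameter `σ = ‖∑ₖ Aₖ²‖^{1/2}` (spectral norm). -/
def sigma {n s : ℕ} (A : Fin s → Matrix (Fin n) (Fin n) ℝ) : ℝ :=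
  ‖∑ k, A k ^ 2‖ ^ (1 / 2 : ℝ)

/-- A real matrix regarded as a complex matrix. -/
def toComplex {n : ℕ} (A : Matrix (Fin n) (Fin n) ℝ) : Matrix (Fin n) (Fin n) ℂ :=
  A.map Complex.ofReal

/-- The matrix `∑ₖₗ Aₖ U₁ Aₗ U₂ Aₖ U₃ Aₗ`. -/
def twistedSum {n s : ℕ} (A : Fin s → Matrix (Fin n) (Fin n) ℝ)
    (U₁ U₂ U₃ : Matrix (Fin n) (Fin n) ℂ) : Matrix (Fin n) (Fin n) ℂ :=
  ∑ k, ∑ l, toComplex (A k) * U₁ * toComplex (A l) * U₂ * toComplex (A k) * U₃ * toComplex (A l)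

/-- The values `‖∑ₖₗ Aₖ U₁ Aₗ U₂ Aₖ U₃ Aₗ‖^{1/4}` (spectral norm), where `U₁, U₂, U₃` are
pairwise commuting complex unitary matrices. -/
def twistedValues {n s : ℕ} (A : Fin s → Matrix (Fin n) (Fin n) ℝ) : Set ℝ :=
  {r | ∃ U₁ ∈ Matrix.unitaryGroup (Fin n) ℂ, ∃ U₂ ∈ Matrix.unitaryGroup (Fin n) ℂ,
    ∃ U₃ ∈ Matrix.unitaryGroup (Fin n) ℂ,
      Commute U₁ U₂ ∧ Commute U₁ U₃ ∧ Commute U₂ U₃ ∧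
      r = ‖twistedSum A U₁ U₂ U₃‖ ^ (1 / 4 : ℝ)}

/-- The second-order parameter `σ̃`. -/
def sigmaTilde {n s : ℕ} (A : Fin s → Matrix (Fin n) (Fin n) ℝ) : ℝ :=
  sSup (twistedValues A)

theorem twistedValues_nonempty {n s : ℕ} (A : Fin s → Matrix (Fin n) (Fin n) ℝ) :
    (twistedValues A).Nonempty :=
  ⟨_, 1, one_mem _, 1, one_mem _, 1, one_mem _, Commute.one_left _, Commute.one_left _,
    Commute.one_left _, rfl⟩

/-- The supremum defining `σ̃` is a genuine one. -/
theorem twistedValues_bddAbove {n s : ℕ} (A : Fin s → Matrix (Fin n) (Fin n) ℝ) :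
    BddAbove (twistedValues A) := by
  have hU : ∀ U ∈ Matrix.unitaryGroup (Fin n) ℂ, ‖U‖ ≤ 1 := by
    intro U hU
    rcases subsingleton_or_nontrivial (Matrix (Fin n) (Fin n) ℂ) with h | h
    · rw [Subsingleton.elim U 0, norm_zero]
      exact zero_le_one
    · exact (CStarRing.norm_of_mem_unitary hU).le
  refine ⟨(∑ k, ∑ l, ‖toComplex (A k)‖ * 1 * ‖toComplex (A l)‖ * 1 * ‖toComplex (A k)‖ * 1
    * ‖toComplex (A l)‖) ^ (1 / 4 : ℝ), ?_⟩
  rintro r ⟨U₁, h₁, U₂, h₂, U₃, h₃, -, -, -, rfl⟩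
  refine Real.rpow_le_rpow (norm_nonneg _) ?_ (by norm_num)
  refine norm_sum_le_of_le _ fun k _ => norm_sum_le_of_le _ fun l _ => ?_
  refine (norm_mul_le _ _).trans (mul_le_mul_of_nonneg_right ?_ (norm_nonneg _))
  refine (norm_mul_le _ _).trans (mul_le_mul ?_ (hU _ h₃) (norm_nonneg _) (by positivity))
  refine (norm_mul_le _ _).trans (mul_le_mul_of_nonneg_right ?_ (norm_nonneg _))
  refine (norm_mul_le _ _).trans (mul_le_mul ?_ (hU _ h₂) (norm_nonneg _) (by positivity))
  refine (norm_mul_le _ _).trans (mul_le_mul_of_nonneg_right ?_ (norm_nonneg _))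
  exact (norm_mul_le _ _).trans (mul_le_mul le_rfl (hU _ h₁) (norm_nonneg _) (norm_nonneg _))

end

end StructuredRandomMatrix

/-! The proof is the moment method with two Gaussian integrations by parts. The first turns E Tr
X^(2p) into a sum over l of E Tr A_k X^l A_k X^(2p-2-l). In an eigenbasis of X these traces have
nonnegative weights, so a scalar power inequality (`sum_trace_mul_pow_le`) replaces the terms with l
= 0, 1 or their mirror images by Tr A_k² X^(2p-2), and all others by Tr A_k X² A_k X^(2p-4). The
former cost σ².

Integrating by parts again, in one factor of the X² just isolated, gives a nested pairing, bounded
by σ⁴, and about 2p crossing pairings Tr A_k X^a A_l X^b A_k X^c A_l X^d. The crossing bound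
`abs_crossTrace_pow_le` carries the theorem: powers of X are simultaneously diagonal, and a
layer-cake decomposition reduces the form to sign matrices in three slots. These are commuting
unitaries, so σ̃⁴ applies.

The result is a two-step recursion for the trace moments (`traceMoment_add_two_le`), solved by
induction in `traceMoment_le`. Taking p of order log n makes the dimension factor n^(1/p) bounded.
-/

/-! ### Gaussian moments and integration by parts for polynomials. -/

theorem integrable_pow_gaussianReal (m : ℕ) :
    Integrable (fun x : ℝ => x ^ m) (gaussianReal 0 1) := by
  have h := (memLp_id_gaussianReal' (μ := 0) (v := 1) (m : ENNReal) (by simp)).integrable_norm_pow'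
  refine h.mono' (by fun_prop) (Filter.Eventually.of_forall fun x => ?_)
  simp

theorem integral_gaussianReal_eq_integral_mul_pdf (f : ℝ → ℝ) :
    ∫ x, f x ∂(gaussianReal 0 1) = ∫ x, f x * gaussianPDFReal 0 1 x := by
  rw [integral_gaussianReal_eq_integral_smul one_ne_zero]
  simp [mul_comm]

theorem integrable_pow_mul_gaussianPDFReal (m : ℕ) :
    Integrable (fun x : ℝ => x ^ m * gaussianPDFReal 0 1 x) := by
  have h := integrable_pow_gaussianReal m
  rw [gaussianReal_of_var_ne_zero _ one_ne_zero,
    integrable_withDensity_iff (measurable_gaussianPDF _ _) (by simp [gaussianPDF_lt_top])] at h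
  simpa [toReal_gaussianPDF] using h

theorem hasDerivAt_gaussianPDFReal (x : ℝ) :
    HasDerivAt (gaussianPDFReal 0 1) (-(x * gaussianPDFReal 0 1 x)) x := by
  have h : HasDerivAt (fun y : ℝ => -(y - 0) ^ 2 / (2 * ((1 : NNReal) : ℝ))) (-x) x :=
    ((((hasDerivAt_id x).sub_const 0).pow 2).neg.div_const (2 * ((1 : NNReal) : ℝ))).congr_deriv
      (by simp; ring)
  rw [gaussianPDFReal_def]
  exact ((h.exp).const_mul ((√(2 * Real.pi * ((1 : NNReal) : ℝ)))⁻¹)).congr_deriv (by ring)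

/-- Stein's identity for monomials. -/
theorem integral_pow_succ_gaussianReal (m : ℕ) :
    ∫ x, x ^ (m + 1) ∂(gaussianReal 0 1) = m * ∫ x, x ^ (m - 1) ∂(gaussianReal 0 1) := by
  rw [integral_gaussianReal_eq_integral_mul_pdf, integral_gaussianReal_eq_integral_mul_pdf,
    ← integral_const_mul]
  -- The density φ satisfies φ' = -xφ, so one factor x is traded for a derivative of x^m. At m = 0
  -- the truncated exponent m - 1 is harmless, as its coefficient vanishes.
  have h := integral_mul_deriv_eq_deriv_mul_of_integrable (A := ℝ)
    (u := fun x : ℝ => x ^ m) (u' := fun x : ℝ => m * x ^ (m - 1))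
    (v := gaussianPDFReal 0 1) (v' := fun x => -(x * gaussianPDFReal 0 1 x))
    (fun x _ => hasDerivAt_pow m x) (fun x _ => hasDerivAt_gaussianPDFReal x)
    (by
      refine (integrable_pow_mul_gaussianPDFReal (m + 1)).neg.congr (.of_forall fun x => ?_)
      simp only [Pi.neg_apply, Pi.mul_apply]; ring)
    (by
      refine ((integrable_pow_mul_gaussianPDFReal (m - 1)).const_mul (m : ℝ)).congr
        (.of_forall fun x => ?_)
      simp only [Pi.mul_apply]; ring)
    (integrable_pow_mul_gaussianPDFReal m)
  have h1 : ∫ x : ℝ, x ^ (m + 1) * gaussianPDFReal 0 1 x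
      = - ∫ x : ℝ, x ^ m * -(x * gaussianPDFReal 0 1 x) := by
    rw [← integral_neg]; congr 1; ext x; ring
  rw [h1, h, neg_neg]
  congr 1; ext x; ring

namespace StructuredRandomMatrix

/-- The standard Gaussian measure on `ℝˢ`. -/
noncomputable abbrev stdGauss (s : ℕ) : Measure (Fin s → ℝ) :=
  Measure.pi fun _ => gaussianReal 0 1

theorem eval_monomial_eq_prod {s : ℕ} (m : Fin s →₀ ℕ) (c : ℝ) (x : Fin s → ℝ) :
    MvPolynomial.eval x (MvPolynomial.monomial m c) = c * ∏ i, x i ^ m i := by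
  rw [MvPolynomial.eval_monomial, Finsupp.prod_fintype _ _ (by simp)]

theorem integrable_eval_stdGauss {s : ℕ} (p : MvPolynomial (Fin s) ℝ) :
    Integrable (fun x => MvPolynomial.eval x p) (stdGauss s) := by
  induction p using MvPolynomial.induction_on' with
  | add p q hp hq =>
    simp only [map_add]
    exact Integrable.add hp hq
  | monomial m c =>
    simp only [eval_monomial_eq_prod]
    exact (Integrable.fintype_prod (f := fun i (y : ℝ) => y ^ m i)
      fun i => integrable_pow_gaussianReal (m i)).const_mul c

/-- The Gaussian expectation of a polynomial. -/
noncomputable def gaussExp {s : ℕ} : MvPolynomial (Fin s) ℝ →ₗ[ℝ] ℝ where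
  toFun p := ∫ x, MvPolynomial.eval x p ∂(stdGauss s)
  map_add' p q := by
    simp only [map_add]
    exact integral_add (integrable_eval_stdGauss p) (integrable_eval_stdGauss q)
  map_smul' c p := by
    simp only [MvPolynomial.smul_eval, RingHom.id_apply, smul_eq_mul, integral_const_mul]

theorem gaussExp_apply {s : ℕ} (p : MvPolynomial (Fin s) ℝ) :
    gaussExp p = ∫ x, MvPolynomial.eval x p ∂(stdGauss s) := rfl

theorem gaussExp_monomial {s : ℕ} (m : Fin s →₀ ℕ) (c : ℝ) :
    gaussExp (MvPolynomial.monomial m c) =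
      c * ∏ i, ∫ x, x ^ m i ∂(gaussianReal 0 1) := by
  simp only [gaussExp_apply, eval_monomial_eq_prod, integral_const_mul]
  rw [integral_fintype_prod_eq_prod (f := fun i (y : ℝ) => y ^ m i)]

/-- Gaussian integration by parts for polynomials. -/
theorem gaussExp_X_mul {s : ℕ} (k : Fin s) (p : MvPolynomial (Fin s) ℝ) :
    gaussExp (MvPolynomial.X k * p) = gaussExp (MvPolynomial.pderiv k p) := by
  induction p using MvPolynomial.induction_on' with
  | add p q hp hq => simp only [mul_add, map_add, hp, hq]
  | monomial m c =>
    rw [mul_comm, ← pow_one (MvPolynomial.X k), MvPolynomial.X_pow_eq_monomial,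
      MvPolynomial.monomial_mul, MvPolynomial.pderiv_monomial, gaussExp_monomial,
      gaussExp_monomial, ← Finset.mul_prod_erase _ _ (Finset.mem_univ k),
      ← Finset.mul_prod_erase (a := k) _ (fun i => ∫ x, x ^ ((m - Finsupp.single k 1 : Fin s →₀ ℕ) i)
        ∂(gaussianReal 0 1)) (Finset.mem_univ k)]
    have h : ∀ i ∈ Finset.univ.erase k, ∫ x, x ^ ((m + Finsupp.single k 1 : Fin s →₀ ℕ) i) ∂(gaussianReal 0 1)
        = ∫ x, x ^ ((m - Finsupp.single k 1 : Fin s →₀ ℕ) i) ∂(gaussianReal 0 1) := by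
      intro i hi
      have : k ≠ i := (Finset.ne_of_mem_erase hi).symm
      simp [this]
    rw [Finset.prod_congr rfl h]
    have h2 := integral_pow_succ_gaussianReal (m k)
    simp only [Finsupp.coe_add, Pi.add_apply, Finsupp.single_eq_same, Finsupp.coe_tsub,
      Pi.sub_apply, h2]
    ring

end StructuredRandomMatrix

/-! ### Layer-cake interpolation for multilinear forms. -/

section LayerCake

variable {ι : Type*}

/-- A nonnegative function that is monotone with respect to the preorder induced by `μ` is a
nonnegative combination of indicators of upper level sets of `μ`. -/
theorem exists_nonneg_sum_indicator [Fintype ι] (μ h : ι → ℝ) (h0 : ∀ i, 0 ≤ h i)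
    (hm : ∀ i j, μ i ≤ μ j → h i ≤ h j) :
    ∃ c : ι → ℝ, (∀ i, 0 ≤ c i) ∧ ∀ j, h j = ∑ i, if μ i ≤ μ j then c i else 0 := by
  classical
  suffices H : ∀ S : Finset ι, ∃ c : ι → ℝ, (∀ i, 0 ≤ c i) ∧
      ∀ j ∈ S, h j = ∑ i ∈ S, if μ i ≤ μ j then c i else 0 by
    obtain ⟨c, hc, hs⟩ := H Finset.univ
    exact ⟨c, hc, fun j => hs j (Finset.mem_univ j)⟩
  intro S
  induction S using Finset.induction_on_max_value μ with
  | empty => exact ⟨0, fun _ => le_rfl, by simp⟩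
  | insert a S ha hmax ih =>
    obtain ⟨c, hc, hs⟩ := ih
    -- Points enter in increasing order of μ, and the weight of a new point is the increment of h. A
    -- tie in μ forces equal values of h, hence weight zero, so earlier points are undisturbed.
    have hle : ∑ i ∈ S, c i ≤ h a ∧ ∀ j ∈ S, μ a ≤ μ j → h a = ∑ i ∈ S, c i := by
      have key : ∀ j ∈ S, (∀ i ∈ S, μ i ≤ μ j) → ∑ i ∈ S, c i = h j := fun j hj hi => by
        rw [hs j hj]
        exact Finset.sum_congr rfl fun i hiS => (if_pos (hi i hiS)).symm
      constructor
      · rcases S.eq_empty_or_nonempty with rfl | hS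
        · simpa using h0 a
        · obtain ⟨b, hb, hbm⟩ := S.exists_max_image μ hS
          rw [key b hb hbm]
          exact hm _ _ (hmax b hb)
      · intro j hj haj
        rw [key j hj fun i hi => (hmax i hi).trans haj]
        exact le_antisymm (hm _ _ haj) (hm _ _ (hmax j hj))
    refine ⟨Function.update c a (h a - ∑ i ∈ S, c i), fun i => ?_, fun j hj => ?_⟩
    · by_cases hi : i = a
      · subst hi; simpa using hle.1
      · simpa [hi] using hc i
    · have hne : ∀ i ∈ S, i ≠ a := fun i hi e => ha (e ▸ hi)
      have hup : ∀ v : ℝ, (∑ i ∈ S, if μ i ≤ μ j then Function.update c a v i else 0) =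
          ∑ i ∈ S, if μ i ≤ μ j then c i else 0 := fun v =>
        Finset.sum_congr rfl fun i hi => by rw [Function.update_of_ne (hne i hi)]
      rw [Finset.sum_insert ha, Function.update_self, hup]
      rcases Finset.mem_insert.1 hj with rfl | hj
      · have : (∑ i ∈ S, if μ i ≤ μ j then c i else 0) = ∑ i ∈ S, c i :=
          Finset.sum_congr rfl fun i hi => if_pos (hmax i hi)
        rw [if_pos le_rfl, this]
        ring
      · rw [← hs j hj]
        split_ifs with haj
        · rw [hle.2 j hj haj]; ring
        · ring

/-- Layer-cake principle for linear functionals. -/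
theorem abs_linear_mul_le_of_level_sets [Fintype ι] (G : (ι → ℝ) →ₗ[ℝ] ℝ) (w μ h u : ι → ℝ)
    (h0 : ∀ i, 0 ≤ h i) (hm : ∀ i j, μ i ≤ μ j → h i ≤ h j)
    (hG : ∀ t : ℝ, |G fun j => u j * if t ≤ μ j then 1 else 0| ≤
      ∑ j, w j * if t ≤ μ j then 1 else 0) :
    |G fun j => u j * h j| ≤ ∑ j, w j * h j := by
  obtain ⟨c, hc, hs⟩ := exists_nonneg_sum_indicator μ h h0 hm
  have e : (fun j => u j * h j) =
      ∑ i, c i • fun j => u j * if μ i ≤ μ j then (1 : ℝ) else 0 := by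
    ext j
    rw [hs j, Finset.mul_sum, Finset.sum_apply]
    refine Finset.sum_congr rfl fun i _ => ?_
    simp only [Pi.smul_apply, smul_eq_mul]
    split_ifs <;> ring
  have e2 : ∑ j, w j * h j = ∑ i, c i * ∑ j, w j * if μ i ≤ μ j then (1 : ℝ) else 0 := by
    simp_rw [Finset.mul_sum]
    rw [Finset.sum_comm]
    refine Finset.sum_congr rfl fun j _ => ?_
    rw [hs j, Finset.mul_sum]
    refine Finset.sum_congr rfl fun i _ => ?_
    split_ifs <;> ring
  rw [e, e2, map_sum]
  refine (Finset.abs_sum_le_sum_abs _ _).trans (Finset.sum_le_sum fun i _ => ?_)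
  rw [map_smul, smul_eq_mul, abs_mul, abs_of_nonneg (hc i)]
  exact mul_le_mul_of_nonneg_left (hG _) (hc i)

/-- A function with values 0, 1, -1 is the average of two sign functions, obtained by replacing its
zeros by 1 and by -1. This passes from signs, which give unitaries, to signed indicators of level
sets. -/
theorem abs_linear_le_of_signs (G : (ι → ℝ) →ₗ[ℝ] ℝ) (K : ℝ)
    (hG : ∀ f : ι → ℝ, (∀ j, f j = 1 ∨ f j = -1) → |G f| ≤ K)
    (f : ι → ℝ) (hf : ∀ j, f j = 0 ∨ f j = 1 ∨ f j = -1) : |G f| ≤ K := by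
  have e : f = (1 / 2 : ℝ) • ((fun j => if f j = 0 then 1 else f j) +
      fun j => if f j = 0 then -1 else f j) := by
    ext j
    simp only [Pi.smul_apply, Pi.add_apply, smul_eq_mul]
    split_ifs with h
    · rw [h]; ring
    · ring
  have h1 := hG (fun j => if f j = 0 then 1 else f j) fun j => by
    rcases hf j with h | h | h <;> simp [h]
  have h2 := hG (fun j => if f j = 0 then -1 else f j) fun j => by
    rcases hf j with h | h | h <;> simp [h]
  rw [e, map_smul, map_add, smul_eq_mul]
  rw [abs_le] at *
  constructor <;> linarith [h1.1, h1.2, h2.1, h2.2]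

theorem sign_mul_indicator_cases {u : ι → ℝ} (hu : ∀ j, u j = 1 ∨ u j = -1) (μ : ι → ℝ) (t : ℝ)
    (j : ι) : (u j * if t ≤ μ j then (1 : ℝ) else 0) = 0 ∨
      (u j * if t ≤ μ j then (1 : ℝ) else 0) = 1 ∨
      (u j * if t ≤ μ j then (1 : ℝ) else 0) = -1 := by
  rcases hu j with h | h <;> split_ifs <;> simp [h]

/-- Interpolation for cyclically invariant quadrilinear forms evaluated at comonotone functions
(up to signs). -/
theorem abs_quadrilinear_le [Fintype ι] (L : (ι → ℝ) → (ι → ℝ) → (ι → ℝ) → (ι → ℝ) →ₗ[ℝ] ℝ)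
    (rot : ∀ a b c d, L a b c d = L d a b c) (K : ℝ)
    (hK : ∀ a b c : ι → ℝ, (∀ j, a j = 1 ∨ a j = -1) → (∀ j, b j = 1 ∨ b j = -1) →
      (∀ j, c j = 1 ∨ c j = -1) → ∀ d, |L a b c d| ≤ K * ∑ j, |d j|)
    (μ : ι → ℝ) (u h : Fin 4 → ι → ℝ) (hu : ∀ i j, u i j = 1 ∨ u i j = -1)
    (h0 : ∀ i j, 0 ≤ h i j) (hm : ∀ r i j, μ i ≤ μ j → h r i ≤ h r j) :
    |L (fun j => u 0 j * h 0 j) (fun j => u 1 j * h 1 j) (fun j => u 2 j * h 2 j)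
      (fun j => u 3 j * h 3 j)| ≤ ∑ j, K * h 0 j * h 1 j * h 2 j * h 3 j := by
  have hK1 : ∀ a b c : ι → ℝ, (∀ j, a j = 0 ∨ a j = 1 ∨ a j = -1) →
      (∀ j, b j = 0 ∨ b j = 1 ∨ b j = -1) → (∀ j, c j = 0 ∨ c j = 1 ∨ c j = -1) →
      ∀ d, |L a b c d| ≤ K * ∑ j, |d j| := by
    intro a b c ha hb hc d
    -- Only the last slot is linear by type; rotation moves each slot there in turn.
    rw [rot, rot, rot]
    refine abs_linear_le_of_signs _ _ (fun a ha => ?_) a ha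
    rw [rot, rot, rot]
    refine abs_linear_le_of_signs _ _ (fun b hb => ?_) b hb
    rw [rot, rot, rot]
    refine abs_linear_le_of_signs _ _ (fun c hc => ?_) c hc
    rw [rot, rot, rot]
    exact hK a b c ha hb hc d
  have abs_ind : ∀ (r : Fin 4) (t : ℝ) (j : ι),
      |u r j * if t ≤ μ j then (1 : ℝ) else 0| = if t ≤ μ j then (1 : ℝ) else 0 := by
    intro r t j
    rcases hu r j with h | h <;> split_ifs <;> simp [h]
  have hbase : ∀ t₀ t₁ t₂ t₃ : ℝ,
      |L (fun j => u 0 j * if t₀ ≤ μ j then 1 else 0) (fun j => u 1 j * if t₁ ≤ μ j then 1 else 0)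
        (fun j => u 2 j * if t₂ ≤ μ j then 1 else 0)
        (fun j => u 3 j * if t₃ ≤ μ j then 1 else 0)| ≤
      ∑ j, K * (if t₀ ≤ μ j then 1 else 0) * (if t₁ ≤ μ j then 1 else 0) *
        (if t₂ ≤ μ j then 1 else 0) * (if t₃ ≤ μ j then 1 else 0) := by
    intro t₀ t₁ t₂ t₃
    have c := fun (r : Fin 4) => sign_mul_indicator_cases (hu r) μ
    have b3 := hK1 _ _ _ (c 0 t₀) (c 1 t₁) (c 2 t₂) (fun j => u 3 j * if t₃ ≤ μ j then 1 else 0)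
    have b2 := hK1 _ _ _ (c 3 t₃) (c 0 t₀) (c 1 t₁) (fun j => u 2 j * if t₂ ≤ μ j then 1 else 0)
    have b1 := hK1 _ _ _ (c 2 t₂) (c 3 t₃) (c 0 t₀) (fun j => u 1 j * if t₁ ≤ μ j then 1 else 0)
    have b0 := hK1 _ _ _ (c 1 t₁) (c 2 t₂) (c 3 t₃) (fun j => u 0 j * if t₀ ≤ μ j then 1 else 0)
    rw [← rot] at b2
    rw [← rot, ← rot] at b1
    rw [← rot, ← rot, ← rot] at b0
    simp only [abs_ind, Finset.mul_sum] at b0 b1 b2 b3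
    -- The level sets are nested, so the product of the four indicators is the one with the largest
    -- threshold. The ℓ¹ bound is used in that slot.
    have hmax : (t₁ ≤ t₀ ∧ t₂ ≤ t₀ ∧ t₃ ≤ t₀) ∨ (t₀ ≤ t₁ ∧ t₂ ≤ t₁ ∧ t₃ ≤ t₁) ∨
        (t₀ ≤ t₂ ∧ t₁ ≤ t₂ ∧ t₃ ≤ t₂) ∨ (t₀ ≤ t₃ ∧ t₁ ≤ t₃ ∧ t₂ ≤ t₃) := by
      grind
    rcases hmax with ⟨p, q, r⟩ | ⟨p, q, r⟩ | ⟨p, q, r⟩ | ⟨p, q, r⟩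
    · refine b0.trans_eq (Finset.sum_congr rfl fun j _ => ?_)
      by_cases hj : t₀ ≤ μ j <;> simp [hj, p.trans, q.trans, r.trans]
    · refine b1.trans_eq (Finset.sum_congr rfl fun j _ => ?_)
      by_cases hj : t₁ ≤ μ j <;> simp [hj, p.trans, q.trans, r.trans]
    · refine b2.trans_eq (Finset.sum_congr rfl fun j _ => ?_)
      by_cases hj : t₂ ≤ μ j <;> simp [hj, p.trans, q.trans, r.trans]
    · refine b3.trans_eq (Finset.sum_congr rfl fun j _ => ?_)
      by_cases hj : t₃ ≤ μ j <;> simp [hj, p.trans, q.trans, r.trans]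
  -- Each h is replaced by level-set indicators one slot at a time; the functions not yet treated
  -- remain in the weight w.
  refine abs_linear_mul_le_of_level_sets _ _ μ _ _ (h0 3) (hm 3) fun t₃ => ?_
  rw [rot]
  refine (abs_linear_mul_le_of_level_sets _ (fun j => K * h 0 j * h 1 j *
    if t₃ ≤ μ j then 1 else 0) μ _ _ (h0 2) (hm 2) fun t₂ => ?_).trans_eq
    (Finset.sum_congr rfl fun j _ => by ring)
  rw [rot]
  refine (abs_linear_mul_le_of_level_sets _ (fun j => K * h 0 j * (if t₂ ≤ μ j then 1 else 0) *
    if t₃ ≤ μ j then 1 else 0) μ _ _ (h0 1) (hm 1) fun t₁ => ?_).trans_eq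
    (Finset.sum_congr rfl fun j _ => by ring)
  rw [rot]
  refine (abs_linear_mul_le_of_level_sets _ (fun j => K * (if t₁ ≤ μ j then 1 else 0) *
    (if t₂ ≤ μ j then 1 else 0) * if t₃ ≤ μ j then 1 else 0) μ _ _ (h0 0) (hm 0)
    fun t₀ => ?_).trans_eq (Finset.sum_congr rfl fun j _ => by ring)
  rw [rot]
  exact (hbase t₀ t₁ t₂ t₃).trans_eq (Finset.sum_congr rfl fun j _ => by ring)

end LayerCake

/-! ### Spectral calculus and the crossing bound. -/

namespace StructuredRandomMatrix

open Matrix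

theorem norm_entry_le_l2_opNorm {𝕜 : Type*} [RCLike 𝕜] {n : ℕ} (M : Matrix (Fin n) (Fin n) 𝕜)
    (i j : Fin n) : ‖M i j‖ ≤ ‖M‖ := by
  have h := l2_opNorm_mulVec M (EuclideanSpace.single j (1 : 𝕜))
  have h2 := PiLp.norm_apply_le (WithLp.toLp 2 (M *ᵥ (EuclideanSpace.single j (1 : 𝕜)).ofLp)) i
  simp at h h2
  exact h2.trans h

theorem dotProduct_mulVec_le {n : ℕ} (M : Matrix (Fin n) (Fin n) ℝ) (y : Fin n → ℝ) :
    y ⬝ᵥ (M *ᵥ y) ≤ ‖M‖ * (y ⬝ᵥ y) := by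
  let T := toEuclideanCLM (n := Fin n) (𝕜 := ℝ) M
  have h := inner_toEuclideanCLM M (WithLp.toLp 2 y) (WithLp.toLp 2 y)
  have h4 : y ⬝ᵥ y = ‖WithLp.toLp 2 y‖ * ‖WithLp.toLp 2 y‖ := by
    rw [← real_inner_self_eq_norm_mul_norm, EuclideanSpace.inner_eq_star_dotProduct]
    simp
  calc y ⬝ᵥ (M *ᵥ y) = inner ℝ (WithLp.toLp 2 y) (T (WithLp.toLp 2 y)) := h.symm
    _ ≤ ‖WithLp.toLp 2 y‖ * ‖T (WithLp.toLp 2 y)‖ := real_inner_le_norm _ _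
    _ ≤ ‖WithLp.toLp 2 y‖ * (‖M‖ * ‖WithLp.toLp 2 y‖) :=
        mul_le_mul_of_nonneg_left (T.le_opNorm _) (norm_nonneg _)
    _ = ‖M‖ * (y ⬝ᵥ y) := by rw [h4]; ring

theorem trace_mul_mul_transpose_le {n : ℕ} (M Y : Matrix (Fin n) (Fin n) ℝ) :
    (M * (Y * Yᵀ)).trace ≤ ‖M‖ * (Y * Yᵀ).trace := by
  have h : ∀ N : Matrix (Fin n) (Fin n) ℝ,
      (N * (Y * Yᵀ)).trace = ∑ j, Yᵀ j ⬝ᵥ (N *ᵥ Yᵀ j) := by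
    intro N
    rw [← Matrix.mul_assoc, trace_mul_comm]
    rfl
  have h1 := h 1
  rw [Matrix.one_mul] at h1
  rw [h, h1, Finset.mul_sum]
  refine Finset.sum_le_sum fun j _ => ?_
  rw [one_mulVec]
  exact dotProduct_mulVec_le M _

/-- The matrix with eigenvalues `f` and eigenvectors the columns of `V`. -/
noncomputable def conjDiag {n : ℕ} (V : Matrix (Fin n) (Fin n) ℝ) :
    (Fin n → ℝ) →ₗ[ℝ] Matrix (Fin n) (Fin n) ℝ where
  toFun f := V * diagonal f * Vᵀ
  map_add' f g := by
    rw [← Matrix.add_mul, ← Matrix.mul_add, diagonal_add]; rfl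
  map_smul' c f := by
    rw [diagonal_smul]; simp

theorem conjDiag_apply {n : ℕ} (V : Matrix (Fin n) (Fin n) ℝ) (f : Fin n → ℝ) :
    conjDiag V f = V * diagonal f * Vᵀ := rfl

theorem conjDiag_mul {n : ℕ} {V : Matrix (Fin n) (Fin n) ℝ} (hV : Vᵀ * V = 1) (f g : Fin n → ℝ) :
    conjDiag V f * conjDiag V g = conjDiag V (f * g) := by
  simp only [conjDiag_apply]
  calc V * diagonal f * Vᵀ * (V * diagonal g * Vᵀ)
      = V * diagonal f * (Vᵀ * V) * diagonal g * Vᵀ := by simp only [Matrix.mul_assoc]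
    _ = _ := by rw [hV, Matrix.mul_one, Matrix.mul_assoc V, diagonal_mul_diagonal]; rfl

theorem conjDiag_one {n : ℕ} {V : Matrix (Fin n) (Fin n) ℝ} (hV : V * Vᵀ = 1) :
    conjDiag V 1 = 1 := by
  rw [conjDiag_apply, Pi.one_def, diagonal_one, Matrix.mul_one, hV]

theorem conjDiag_pow {n : ℕ} {V : Matrix (Fin n) (Fin n) ℝ} (hV : Vᵀ * V = 1) (f : Fin n → ℝ)
    (m : ℕ) : conjDiag V f ^ m = conjDiag V (fun j => f j ^ m) := by
  induction m with
  | zero =>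
    simp only [pow_zero]
    exact (conjDiag_one (mul_eq_one_comm.1 hV)).symm
  | succ m ih =>
    rw [pow_succ, ih, conjDiag_mul hV]
    rfl

theorem transpose_conjDiag {n : ℕ} (V : Matrix (Fin n) (Fin n) ℝ) (f : Fin n → ℝ) :
    (conjDiag V f)ᵀ = conjDiag V f := by
  simp [conjDiag_apply, Matrix.mul_assoc]

theorem trace_conjDiag {n : ℕ} {V : Matrix (Fin n) (Fin n) ℝ} (hV : Vᵀ * V = 1) (f : Fin n → ℝ) :
    (conjDiag V f).trace = ∑ j, f j := by
  rw [conjDiag_apply, trace_mul_comm, ← Matrix.mul_assoc, hV, Matrix.one_mul, trace_diagonal]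

theorem trace_mul_conjDiag {n : ℕ} (V M : Matrix (Fin n) (Fin n) ℝ) (f : Fin n → ℝ) :
    (M * conjDiag V f).trace = ∑ j, (Vᵀ * M * V) j j * f j := by
  rw [conjDiag_apply, ← Matrix.mul_assoc, trace_mul_comm]
  simp only [← Matrix.mul_assoc]
  simp [trace, mul_diagonal]

theorem exists_eq_conjDiag {n : ℕ} {X : Matrix (Fin n) (Fin n) ℝ} (hX : X.IsSymm) :
    ∃ (V : Matrix (Fin n) (Fin n) ℝ) (lam : Fin n → ℝ), Vᵀ * V = 1 ∧ X = conjDiag V lam := by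
  have hH : X.IsHermitian := by
    rw [IsHermitian, conjTranspose_eq_transpose_of_trivial]; exact hX
  refine ⟨hH.eigenvectorUnitary, hH.eigenvalues, ?_, ?_⟩
  · have := (Matrix.mem_unitaryGroup_iff').1 hH.eigenvectorUnitary.2
    rwa [star_eq_conjTranspose, conjTranspose_eq_transpose_of_trivial] at this
  · have := hH.spectral_theorem
    rw [Unitary.conjStarAlgAut_apply, star_eq_conjTranspose,
      conjTranspose_eq_transpose_of_trivial] at this
    exact this

section toComplex

variable {n : ℕ}

theorem toComplex_mul (M N : Matrix (Fin n) (Fin n) ℝ) :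
    toComplex (M * N) = toComplex M * toComplex N :=
  Matrix.map_mul (f := Complex.ofRealHom)

theorem toComplex_one : toComplex (1 : Matrix (Fin n) (Fin n) ℝ) = 1 :=
  Matrix.map_one _ Complex.ofReal_zero Complex.ofReal_one

theorem toComplex_sum {ι : Type*} (S : Finset ι) (M : ι → Matrix (Fin n) (Fin n) ℝ) :
    toComplex (∑ i ∈ S, M i) = ∑ i ∈ S, toComplex (M i) :=
  map_sum (Complex.ofRealHom.mapMatrix (m := Fin n)) M S

theorem toComplex_mem_unitaryGroup {V : Matrix (Fin n) (Fin n) ℝ} (hV : Vᵀ * V = 1) :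
    toComplex V ∈ unitaryGroup (Fin n) ℂ := by
  rw [mem_unitaryGroup_iff']
  have : star (toComplex V) = toComplex Vᵀ := by
    ext i j
    simp [toComplex]
  rw [this, ← toComplex_mul, hV, toComplex_one]

theorem norm_toComplex_conj_le {V : Matrix (Fin n) (Fin n) ℝ} (hV : Vᵀ * V = 1)
    (M : Matrix (Fin n) (Fin n) ℝ) : ‖toComplex (Vᵀ * M * V)‖ ≤ ‖toComplex M‖ := by
  have h1 := toComplex_mem_unitaryGroup hV
  have h2 : toComplex Vᵀ ∈ unitaryGroup (Fin n) ℂ :=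
    toComplex_mem_unitaryGroup (by rw [transpose_transpose]; exact mul_eq_one_comm.1 hV)
  rw [toComplex_mul, toComplex_mul, CStarRing.norm_mul_mem_unitary _ h1,
    CStarRing.norm_mem_unitary_mul _ h2]

/-- Only the diagonal of M in the basis V enters, and each entry is at most the operator norm. The
norm is that of the complexification because σ̃ is defined with complex matrices. -/
theorem abs_trace_mul_conjDiag_le {V : Matrix (Fin n) (Fin n) ℝ} (hV : Vᵀ * V = 1)
    (M : Matrix (Fin n) (Fin n) ℝ) (f : Fin n → ℝ) :
    |(M * conjDiag V f).trace| ≤ ‖toComplex M‖ * ∑ j, |f j| := by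
  rw [trace_mul_conjDiag, Finset.mul_sum]
  refine (Finset.abs_sum_le_sum_abs _ _).trans (Finset.sum_le_sum fun j _ => ?_)
  rw [abs_mul]
  refine mul_le_mul_of_nonneg_right ?_ (abs_nonneg _)
  refine le_trans (le_of_eq ?_) ((norm_entry_le_l2_opNorm (toComplex (Vᵀ * M * V)) j j).trans
    (norm_toComplex_conj_le hV M))
  simp [toComplex]

end toComplex

theorem norm_twistedSum_le {n s : ℕ} (A : Fin s → Matrix (Fin n) (Fin n) ℝ)
    {U₁ U₂ U₃ : Matrix (Fin n) (Fin n) ℂ} (h₁ : U₁ ∈ unitaryGroup (Fin n) ℂ)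
    (h₂ : U₂ ∈ unitaryGroup (Fin n) ℂ) (h₃ : U₃ ∈ unitaryGroup (Fin n) ℂ)
    (h₁₂ : Commute U₁ U₂) (h₁₃ : Commute U₁ U₃) (h₂₃ : Commute U₂ U₃) :
    ‖twistedSum A U₁ U₂ U₃‖ ≤ sigmaTilde A ^ 4 := by
  have h := le_csSup (twistedValues_bddAbove A)
    ⟨U₁, h₁, U₂, h₂, U₃, h₃, h₁₂, h₁₃, h₂₃, rfl⟩
  have h' := pow_le_pow_left₀ (by positivity) h 4
  rwa [← Real.rpow_natCast, ← Real.rpow_mul (norm_nonneg _), show (1 / 4 : ℝ) * ((4 : ℕ) : ℝ) = 1 by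
    norm_num, Real.rpow_one] at h'

theorem sigmaTilde_nonneg {n s : ℕ} (A : Fin s → Matrix (Fin n) (Fin n) ℝ) : 0 ≤ sigmaTilde A := by
  refine Real.sSup_nonneg ?_
  rintro r ⟨U₁, -, U₂, -, U₃, -, -, -, -, rfl⟩
  positivity

/-- The quadrilinear form `∑ₖₗ Tr (Aₖ D₁ Aₗ D₂ Aₖ D₃ Aₗ D₄)`, as a linear map of `D₄`. -/
noncomputable def crossTrace {n s : ℕ} (A : Fin s → Matrix (Fin n) (Fin n) ℝ)
    (D₁ D₂ D₃ : Matrix (Fin n) (Fin n) ℝ) : Matrix (Fin n) (Fin n) ℝ →ₗ[ℝ] ℝ :=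
  traceLinearMap (Fin n) ℝ ℝ ∘ₗ
    LinearMap.mulLeft ℝ (∑ k, ∑ l, A k * D₁ * A l * D₂ * A k * D₃ * A l)

theorem crossTrace_apply {n s : ℕ} (A : Fin s → Matrix (Fin n) (Fin n) ℝ)
    (D₁ D₂ D₃ D₄ : Matrix (Fin n) (Fin n) ℝ) :
    crossTrace A D₁ D₂ D₃ D₄ =
      ∑ k, ∑ l, (A k * D₁ * A l * D₂ * A k * D₃ * A l * D₄).trace := by
  simp [crossTrace, Finset.sum_mul]

/-- Cyclicity of the trace moves the last A_l D₄ to the front. This exchanges the roles of k and l,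
and the pattern k, l, k, l is symmetric under that exchange. -/
theorem crossTrace_rotate {n s : ℕ} (A : Fin s → Matrix (Fin n) (Fin n) ℝ)
    (D₁ D₂ D₃ D₄ : Matrix (Fin n) (Fin n) ℝ) :
    crossTrace A D₁ D₂ D₃ D₄ = crossTrace A D₄ D₁ D₂ D₃ := by
  rw [crossTrace_apply, crossTrace_apply, Finset.sum_comm]
  refine Finset.sum_congr rfl fun l _ => Finset.sum_congr rfl fun k _ => ?_
  rw [show A k * D₁ * A l * D₂ * A k * D₃ * A l * D₄ =
    (A k * D₁ * A l * D₂ * A k * D₃) * (A l * D₄) by simp only [Matrix.mul_assoc], trace_mul_comm]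
  simp only [Matrix.mul_assoc]

theorem abs_crossTrace_conjDiag_le {n s : ℕ} (A : Fin s → Matrix (Fin n) (Fin n) ℝ)
    {V : Matrix (Fin n) (Fin n) ℝ} (hV : Vᵀ * V = 1) (a b c : Fin n → ℝ)
    (ha : ∀ j, a j = 1 ∨ a j = -1) (hb : ∀ j, b j = 1 ∨ b j = -1) (hc : ∀ j, c j = 1 ∨ c j = -1)
    (d : Fin n → ℝ) :
    |crossTrace A (conjDiag V a) (conjDiag V b) (conjDiag V c) (conjDiag V d)| ≤
      sigmaTilde A ^ 4 * ∑ j, |d j| := by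
  have hu : ∀ f : Fin n → ℝ, (∀ j, f j = 1 ∨ f j = -1) →
      toComplex (conjDiag V f) ∈ unitaryGroup (Fin n) ℂ := fun f hf => by
    refine toComplex_mem_unitaryGroup ?_
    rw [transpose_conjDiag, conjDiag_mul hV, ← conjDiag_one (mul_eq_one_comm.1 hV)]
    congr 1
    ext j
    rcases hf j with h | h <;> simp [h]
  have hcomm : ∀ f g : Fin n → ℝ, Commute (toComplex (conjDiag V f)) (toComplex (conjDiag V g)) :=
    fun f g => by
      rw [Commute, SemiconjBy, ← toComplex_mul, ← toComplex_mul, conjDiag_mul hV, conjDiag_mul hV,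
        mul_comm]
  have h := norm_twistedSum_le A (hu a ha) (hu b hb) (hu c hc) (hcomm a b) (hcomm a c) (hcomm b c)
  refine (abs_trace_mul_conjDiag_le hV _ d).trans
    (mul_le_mul_of_nonneg_right (le_of_eq_of_le ?_ h) (by positivity))
  simp only [toComplex_sum, toComplex_mul, twistedSum]

/-- Individual exponents may be odd, so each eigenvalue power is split into a sign and a power of
|λ|. The latter are all monotone in |λ|, as the interpolation requires; only the total exponent has
to be even. -/
theorem abs_crossTrace_pow_le {n s : ℕ} (A : Fin s → Matrix (Fin n) (Fin n) ℝ)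
    {X : Matrix (Fin n) (Fin n) ℝ} (hX : X.IsSymm) (a b c d q : ℕ) (hq : a + b + c + d = 2 * q) :
    |crossTrace A (X ^ a) (X ^ b) (X ^ c) (X ^ d)| ≤ sigmaTilde A ^ 4 * (X ^ (2 * q)).trace := by
  obtain ⟨V, lam, hV, rfl⟩ := exists_eq_conjDiag hX
  let e : Fin 4 → ℕ := ![a, b, c, d]
  let sgn : Fin n → ℝ := fun j => if 0 ≤ lam j then 1 else -1
  have hs : ∀ j, sgn j = 1 ∨ sgn j = -1 := fun j => by
    by_cases h : 0 ≤ lam j <;> simp [sgn, h]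
  have hl : ∀ (m : ℕ) (j), lam j ^ m = sgn j ^ m * |lam j| ^ m := fun m j => by
    rw [← mul_pow]
    by_cases h : 0 ≤ lam j
    · simp [sgn, h, abs_of_nonneg h]
    · simp [sgn, h, abs_of_neg (not_le.1 h)]
  have key := abs_quadrilinear_le
    (fun f₁ f₂ f₃ => crossTrace A (conjDiag V f₁) (conjDiag V f₂) (conjDiag V f₃) ∘ₗ conjDiag V)
    (fun f₁ f₂ f₃ f₄ => crossTrace_rotate A _ _ _ _) (sigmaTilde A ^ 4)
    (fun f₁ f₂ f₃ h₁ h₂ h₃ d => abs_crossTrace_conjDiag_le A hV f₁ f₂ f₃ h₁ h₂ h₃ d)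
    (fun j => |lam j|) (fun i j => sgn j ^ e i) (fun i j => |lam j| ^ e i)
    (fun i j => by
      rcases hs j with h | h
      · simp [h]
      · rw [h]; exact neg_one_pow_eq_or ℝ (e i))
    (fun i j => by positivity) (fun r i j h => pow_le_pow_left₀ (abs_nonneg _) h _)
  simp only [← hl] at key
  simp only [conjDiag_pow hV, trace_conjDiag hV]
  refine key.trans_eq ?_
  rw [Finset.mul_sum]
  refine Finset.sum_congr rfl fun j _ => ?_
  rw [← (even_two_mul q).pow_abs (lam j), ← hq]
  simp only [e, pow_add]
  simp
  ring

end StructuredRandomMatrix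

/-! ### Comparing the terms of the first integration by parts. -/

/-- The difference of the two sides is u^i v^i (u^t - v^t)(u^w - v^w), whose last two factors have
the same sign. -/
theorem pow_pair_le {u v : ℝ} (hu : 0 ≤ u) (hv : 0 ≤ v) (i t w : ℕ) :
    u ^ (i + t) * v ^ (i + w) + u ^ (i + w) * v ^ (i + t) ≤
      u ^ (i + t + w) * v ^ i + u ^ i * v ^ (i + t + w) := by
  have h : 0 ≤ (u ^ t - v ^ t) * (u ^ w - v ^ w) := by
    rcases le_total u v with h | h
    · exact mul_nonneg_of_nonpos_of_nonpos (sub_nonpos.2 (pow_le_pow_left₀ hu h _))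
        (sub_nonpos.2 (pow_le_pow_left₀ hu h _))
    · exact mul_nonneg (sub_nonneg.2 (pow_le_pow_left₀ hv h _))
        (sub_nonneg.2 (pow_le_pow_left₀ hv h _))
  have h2 := mul_nonneg (mul_nonneg (pow_nonneg hu i) (pow_nonneg hv i)) h
  simp only [pow_add]
  linarith

theorem pow_mul_pow_symm_le (x y : ℝ) (i l r : ℕ) (hi : i ≤ l) (hl : i + l ≤ 2 * r) :
    x ^ l * y ^ (2 * r - l) + x ^ (2 * r - l) * y ^ l ≤
      |x| ^ (2 * r - i) * |y| ^ i + |x| ^ i * |y| ^ (2 * r - i) := by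
  obtain ⟨t, rfl⟩ := Nat.exists_eq_add_of_le hi
  obtain ⟨w, hw⟩ := Nat.exists_eq_add_of_le hl
  have e1 : 2 * r - (i + t) = i + w := by omega
  have e2 : 2 * r - i = i + t + w := by omega
  rw [e1, e2]
  refine le_trans (add_le_add ?_ ?_) (pow_pair_le (abs_nonneg x) (abs_nonneg y) i t w)
  · rw [← abs_pow, ← abs_pow, ← abs_mul]; exact le_abs_self _
  · rw [← abs_pow, ← abs_pow, ← abs_mul]; exact le_abs_self _

theorem sum_pow_mul_pow_le (x y : ℝ) (q : ℕ) :
    ∑ l ∈ Finset.range (2 * (q + 1) + 1), x ^ l * y ^ (2 * (q + 1) - l) ≤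
      2 * (x ^ (2 * (q + 1)) + y ^ (2 * (q + 1))) +
        (2 * (q + 1) + 1) / 2 * (x ^ 2 * y ^ (2 * q) + x ^ (2 * q) * y ^ 2) := by
  set N := 2 * (q + 1) with hN
  have hx : ∀ (z : ℝ) (m : ℕ), |z| ^ (2 * m) = z ^ (2 * m) := fun z m =>
    (even_two_mul m).pow_abs z
  have hrefl : ∑ l ∈ Finset.range (N + 1), x ^ (N - l) * y ^ l =
      ∑ l ∈ Finset.range (N + 1), x ^ l * y ^ (N - l) := by
    rw [← Finset.sum_range_reflect]
    refine Finset.sum_congr rfl fun l hl => ?_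
    have : l ≤ N := Nat.lt_succ_iff.1 (Finset.mem_range.1 hl)
    rw [show N + 1 - 1 - l = N - l by omega, show N - (N - l) = l by omega]
  set a := x ^ N + y ^ N
  set b := x ^ 2 * y ^ (2 * q) + x ^ (2 * q) * y ^ 2
  have ha : 0 ≤ a := by
    have := (even_two_mul (q + 1)).pow_nonneg x
    have := (even_two_mul (q + 1)).pow_nonneg y
    positivity
  have hb : 0 ≤ b := by
    have := (even_two_mul q).pow_nonneg x
    have := (even_two_mul q).pow_nonneg y
    positivity
  -- The terms l = 1 and l = N - 1 cannot be compared with the exponent pair (2, N - 2), so they go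
  -- with the extremes. Each l is paired with N - l, so summing bounds twice the desired sum.
  have hterm : ∀ l ∈ Finset.range (N + 1), x ^ l * y ^ (N - l) + x ^ (N - l) * y ^ l ≤
      ((if l = 0 then a else 0) + (if l = 1 then a else 0) + (if l = N - 1 then a else 0) +
        (if l = N then a else 0)) + b := by
    intro l hl
    have hlN : l ≤ N := Nat.lt_succ_iff.1 (Finset.mem_range.1 hl)
    by_cases h : l = 0 ∨ l = 1 ∨ l = N - 1 ∨ l = N
    · have h1 := pow_mul_pow_symm_le x y 0 l (q + 1) (Nat.zero_le _) (by omega)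
      rw [← hN, Nat.sub_zero, hN, hx, hx, ← hN] at h1
      simp only [pow_zero, mul_one, one_mul] at h1
      have h2 : a ≤ (if l = 0 then a else 0) + (if l = 1 then a else 0) +
          (if l = N - 1 then a else 0) + (if l = N then a else 0) := by
        split_ifs <;> first | linarith | (exfalso; omega)
      exact h1.trans (h2.trans (le_add_of_nonneg_right hb))
    · push Not at h
      have h1 := pow_mul_pow_symm_le x y 2 l (q + 1) (by omega) (by omega)
      rw [show 2 * (q + 1) - 2 = 2 * q by omega, hx, hx, sq_abs, sq_abs, ← hN] at h1
      simp only [h.1, h.2.1, h.2.2.1, h.2.2.2, if_false, zero_add]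
      exact h1.trans_eq (add_comm _ _)
  have hsum := Finset.sum_le_sum hterm
  rw [Finset.sum_add_distrib, hrefl] at hsum
  simp only [Finset.sum_add_distrib, Finset.sum_ite_eq', Finset.mem_range, Finset.sum_const,
    Finset.card_range, nsmul_eq_mul] at hsum
  rw [if_pos (by omega), if_pos (by omega), if_pos (by omega), if_pos (by omega)] at hsum
  have hNc : ((N + 1 : ℕ) : ℝ) = 2 * (q + 1) + 1 := by rw [hN]; push_cast; ring
  rw [hNc] at hsum
  linarith

namespace StructuredRandomMatrix

open Matrix

variable {n : ℕ}

/-- Symmetry of B makes the weights squares, so scalar inequalities between eigenvalues pass to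
traces. -/
theorem trace_mul_conjDiag_mul_conjDiag {B : Matrix (Fin n) (Fin n) ℝ} (hB : B.IsSymm)
    (V : Matrix (Fin n) (Fin n) ℝ) (f g : Fin n → ℝ) :
    (B * conjDiag V f * B * conjDiag V g).trace =
      ∑ i, ∑ j, (Vᵀ * B * V) i j ^ 2 * (f j * g i) := by
  rw [trace_mul_conjDiag]
  have hS : (Vᵀ * B * V)ᵀ = Vᵀ * B * V := by
    simp [transpose_mul, hB.eq, Matrix.mul_assoc]
  refine Finset.sum_congr rfl fun i _ => ?_
  have e : Vᵀ * (B * conjDiag V f * B) * V = (Vᵀ * B * V) * diagonal f * (Vᵀ * B * V) := by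
    simp only [conjDiag_apply, Matrix.mul_assoc]
  rw [e, mul_apply, Finset.sum_mul]
  refine Finset.sum_congr rfl fun j _ => ?_
  have : (Vᵀ * B * V) j i = (Vᵀ * B * V) i j := by
    conv_lhs => rw [← hS]
    rfl
  rw [mul_diagonal, this]
  ring

theorem sum_trace_mul_pow_le {B X : Matrix (Fin n) (Fin n) ℝ} (hB : B.IsSymm) (hX : X.IsSymm)
    (q : ℕ) :
    ∑ l ∈ Finset.range (2 * (q + 1) + 1), (B * X ^ l * B * X ^ (2 * (q + 1) - l)).trace ≤
      4 * (B * B * X ^ (2 * (q + 1))).trace +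
        (2 * (q + 1) + 1) * (B * X ^ 2 * B * X ^ (2 * q)).trace := by
  obtain ⟨V, lam, hV, rfl⟩ := exists_eq_conjDiag hX
  have e0 : B * B = B * conjDiag V (fun j => lam j ^ 0) * B := by
    rw [← conjDiag_pow hV, pow_zero, Matrix.mul_one]
  rw [e0]
  simp only [conjDiag_pow hV, trace_mul_conjDiag_mul_conjDiag hB]
  set S := Vᵀ * B * V with hSdef
  have hS : ∀ i j, S j i = S i j := by
    have : Sᵀ = S := by simp [hSdef, transpose_mul, hB.eq, Matrix.mul_assoc]
    intro i j
    conv_lhs => rw [← this]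
    rfl
  -- The scalar bound is symmetric in the two eigenvalues, so the traces on the right are
  -- symmetrized. The factor 1/2 here turns its coefficients 2 and (N + 1)/2 into 4 and N + 1, with
  -- N = 2(q + 1).
  have hswap : ∀ f g : Fin n → ℝ, ∑ i, ∑ j, S i j ^ 2 * (f j * g i) =
      ∑ i, ∑ j, S i j ^ 2 * ((f j * g i + g j * f i) / 2) := by
    intro f g
    have h : ∑ i, ∑ j, S i j ^ 2 * (f j * g i) = ∑ i, ∑ j, S i j ^ 2 * (g j * f i) := by
      rw [Finset.sum_comm]
      refine Finset.sum_congr rfl fun i _ => Finset.sum_congr rfl fun j _ => ?_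
      rw [hS]; ring
    have h2 : ∑ i, ∑ j, S i j ^ 2 * ((f j * g i + g j * f i) / 2) =
        (∑ i, ∑ j, S i j ^ 2 * (f j * g i) + ∑ i, ∑ j, S i j ^ 2 * (g j * f i)) / 2 := by
      rw [← Finset.sum_add_distrib, Finset.sum_div]
      refine Finset.sum_congr rfl fun i _ => ?_
      rw [← Finset.sum_add_distrib, Finset.sum_div]
      exact Finset.sum_congr rfl fun j _ => by ring
    rw [h2, ← h]; ring
  rw [hswap (fun j => lam j ^ 0), hswap (fun j => lam j ^ 2), Finset.sum_comm, Finset.mul_sum,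
    Finset.mul_sum, ← Finset.sum_add_distrib]
  refine Finset.sum_le_sum fun i _ => ?_
  rw [Finset.sum_comm, Finset.mul_sum, Finset.mul_sum, ← Finset.sum_add_distrib]
  refine Finset.sum_le_sum fun j _ => ?_
  rw [← Finset.mul_sum]
  refine (mul_le_mul_of_nonneg_left (sum_pow_mul_pow_le (lam j) (lam i) q)
    (sq_nonneg (S i j))).trans_eq ?_
  ring

end StructuredRandomMatrix

/-! ### Polynomial matrices and integration by parts under the trace. -/

namespace StructuredRandomMatrix

open Matrix

section PolynomialMatrix

variable {n s : ℕ}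

/-- A real matrix regarded as a matrix of constant polynomials. -/
noncomputable def constMat (M : Matrix (Fin n) (Fin n) ℝ) :
    Matrix (Fin n) (Fin n) (MvPolynomial (Fin s) ℝ) :=
  M.map MvPolynomial.C

/-- The matrix of linear polynomials `∑ₖ xₖ Aₖ`. -/
noncomputable def polySeries (A : Fin s → Matrix (Fin n) (Fin n) ℝ) :
    Matrix (Fin n) (Fin n) (MvPolynomial (Fin s) ℝ) :=
  ∑ k, (MvPolynomial.X k : MvPolynomial (Fin s) ℝ) • constMat (A k)

/-- Entrywise partial derivative of a polynomial matrix. -/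
noncomputable def matDeriv (k : Fin s) (M : Matrix (Fin n) (Fin n) (MvPolynomial (Fin s) ℝ)) :
    Matrix (Fin n) (Fin n) (MvPolynomial (Fin s) ℝ) :=
  M.map (MvPolynomial.pderiv k)

theorem matDeriv_mul (k : Fin s) (M N : Matrix (Fin n) (Fin n) (MvPolynomial (Fin s) ℝ)) :
    matDeriv k (M * N) = matDeriv k M * N + M * matDeriv k N := by
  ext1 i j
  simp only [matDeriv, map_apply, mul_apply, Matrix.add_apply, map_sum, Derivation.leibniz, smul_eq_mul,
    ← Finset.sum_add_distrib]
  exact Finset.sum_congr rfl fun l _ => by ring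

theorem matDeriv_constMat (k : Fin s) (M : Matrix (Fin n) (Fin n) ℝ) :
    matDeriv k (constMat M) = 0 := by
  ext1 i j
  simp [matDeriv, constMat]

theorem constMat_one : (constMat 1 : Matrix (Fin n) (Fin n) (MvPolynomial (Fin s) ℝ)) = 1 :=
  Matrix.map_one _ (map_zero _) (map_one _)

theorem matDeriv_polySeries (A : Fin s → Matrix (Fin n) (Fin n) ℝ) (k : Fin s) :
    matDeriv k (polySeries A) = constMat (A k) := by
  ext1 i j
  simp only [matDeriv, polySeries, map_apply, Matrix.sum_apply, Matrix.smul_apply, smul_eq_mul, map_sum,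
    Derivation.leibniz, constMat, MvPolynomial.pderiv_C, mul_zero, zero_add,
    MvPolynomial.pderiv_X]
  rw [Finset.sum_eq_single k]
  · simp
  · intro l _ hl
    simp [hl]
  · simp

theorem leibniz_pow_eq_sum {S : Type*} [Semiring S] (δ : S → S) (h1 : δ 1 = 0)
    (hδ : ∀ a b, δ (a * b) = δ a * b + a * δ b) (x : S) (m : ℕ) :
    δ (x ^ m) = ∑ i ∈ Finset.range m, x ^ i * δ x * x ^ (m - 1 - i) := by
  induction m with
  | zero => simp [h1]
  | succ m ih =>
    rw [pow_succ, hδ, ih, Finset.sum_range_succ, Finset.sum_mul]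
    congr 1
    · refine Finset.sum_congr rfl fun i hi => ?_
      have := Finset.mem_range.1 hi
      rw [mul_assoc _ _ x, ← pow_succ, show m - 1 - i + 1 = m + 1 - 1 - i by omega]
    · simp

theorem matDeriv_pow (A : Fin s → Matrix (Fin n) (Fin n) ℝ) (k : Fin s) (m : ℕ) :
    matDeriv k (polySeries A ^ m) =
      ∑ i ∈ Finset.range m, polySeries A ^ i * constMat (A k) * polySeries A ^ (m - 1 - i) := by
  have h := leibniz_pow_eq_sum (matDeriv k) (by rw [← constMat_one, matDeriv_constMat])
    (matDeriv_mul k) (polySeries A) m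
  rwa [matDeriv_polySeries] at h

/-- Gaussian integration by parts for traces of polynomial matrices. -/
theorem gaussExp_trace_polySeries_mul (A : Fin s → Matrix (Fin n) (Fin n) ℝ)
    (M : Matrix (Fin n) (Fin n) (MvPolynomial (Fin s) ℝ)) :
    gaussExp (polySeries A * M).trace =
      gaussExp (∑ k, (constMat (A k) * matDeriv k M).trace) := by
  have h1 : (polySeries A * M).trace = ∑ k, MvPolynomial.X k * (constMat (A k) * M).trace := by
    simp [polySeries, Finset.sum_mul, trace_sum]
  rw [h1, map_sum, map_sum]
  refine Finset.sum_congr rfl fun k _ => ?_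
  rw [gaussExp_X_mul]
  congr 1
  have h2 : matDeriv k (constMat (A k) * M) = constMat (A k) * matDeriv k M := by
    rw [matDeriv_mul, matDeriv_constMat, Matrix.zero_mul, zero_add]
  rw [← h2]
  simp [trace, matDeriv, map_sum]

/-- Evaluation of a polynomial matrix at a point. -/
noncomputable def evalMat (x : Fin s → ℝ) :
    Matrix (Fin n) (Fin n) (MvPolynomial (Fin s) ℝ) →+* Matrix (Fin n) (Fin n) ℝ :=
  (MvPolynomial.eval x).mapMatrix

theorem eval_trace (x : Fin s → ℝ) (M : Matrix (Fin n) (Fin n) (MvPolynomial (Fin s) ℝ)) :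
    MvPolynomial.eval x M.trace = (evalMat x M).trace := by
  simp [trace, evalMat]

theorem evalMat_constMat (x : Fin s → ℝ) (M : Matrix (Fin n) (Fin n) ℝ) :
    evalMat x (constMat M) = M := by
  ext i j
  simp [evalMat, constMat]

/-- The series `∑ₖ xₖ Aₖ` at a point. -/
noncomputable def series (A : Fin s → Matrix (Fin n) (Fin n) ℝ) (x : Fin s → ℝ) :
    Matrix (Fin n) (Fin n) ℝ :=
  ∑ k, x k • A k

theorem evalMat_polySeries (A : Fin s → Matrix (Fin n) (Fin n) ℝ) (x : Fin s → ℝ) :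
    evalMat x (polySeries A) = series A x := by
  ext i j
  simp [evalMat, polySeries, constMat, series, Matrix.sum_apply]

theorem isSymm_series {A : Fin s → Matrix (Fin n) (Fin n) ℝ} (hA : ∀ k, (A k).IsSymm)
    (x : Fin s → ℝ) : (series A x).IsSymm := by
  rw [IsSymm, series, transpose_sum]
  exact Finset.sum_congr rfl fun k _ => by rw [transpose_smul, (hA k).eq]

theorem gaussExp_mono {p q : MvPolynomial (Fin s) ℝ}
    (h : ∀ x, MvPolynomial.eval x p ≤ MvPolynomial.eval x q) : gaussExp p ≤ gaussExp q :=
  integral_mono (integrable_eval_stdGauss p) (integrable_eval_stdGauss q) h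

end PolynomialMatrix

/-! ### The recursion for trace moments. -/

section Recursion

variable {n s : ℕ}

/-- The trace moment `E Tr X^{2p}`. -/
noncomputable def traceMoment (A : Fin s → Matrix (Fin n) (Fin n) ℝ) (p : ℕ) : ℝ :=
  gaussExp (polySeries A ^ (2 * p)).trace

theorem sigma_sq (A : Fin s → Matrix (Fin n) (Fin n) ℝ) : sigma A ^ 2 = ‖∑ k, A k * A k‖ := by
  rw [sigma, ← Real.rpow_natCast, ← Real.rpow_mul (norm_nonneg _)]
  simp [pow_two]

theorem sigma_nonneg (A : Fin s → Matrix (Fin n) (Fin n) ℝ) : 0 ≤ sigma A := by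
  unfold sigma; positivity

theorem trace_mul_pow_even_le (M : Matrix (Fin n) (Fin n) ℝ) {X : Matrix (Fin n) (Fin n) ℝ}
    (hX : X.IsSymm) (q : ℕ) : (M * X ^ (2 * q)).trace ≤ ‖M‖ * (X ^ (2 * q)).trace := by
  have h := trace_mul_mul_transpose_le M (X ^ q)
  rwa [transpose_pow, hX.eq, ← pow_add, ← two_mul] at h

theorem trace_pow_even_nonneg {X : Matrix (Fin n) (Fin n) ℝ} (hX : X.IsSymm) (q : ℕ) :
    0 ≤ (X ^ (2 * q)).trace := by
  obtain ⟨V, lam, hV, rfl⟩ := exists_eq_conjDiag hX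
  rw [conjDiag_pow hV, trace_conjDiag hV]
  exact Finset.sum_nonneg fun j _ => (even_two_mul q).pow_nonneg _

theorem sum_trace_sq_mul_pow_le (A : Fin s → Matrix (Fin n) (Fin n) ℝ)
    {X : Matrix (Fin n) (Fin n) ℝ} (hX : X.IsSymm) (q : ℕ) :
    ∑ k, (A k * A k * X ^ (2 * q)).trace ≤ sigma A ^ 2 * (X ^ (2 * q)).trace := by
  rw [sigma_sq, ← trace_sum, ← Finset.sum_mul]
  exact trace_mul_pow_even_le _ hX q

theorem sum_trace_nested_le {A : Fin s → Matrix (Fin n) (Fin n) ℝ} (hA : ∀ k, (A k).IsSymm)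
    {X : Matrix (Fin n) (Fin n) ℝ} (hX : X.IsSymm) (q : ℕ) :
    ∑ k, ∑ l, (A l * A l * (A k * X ^ (2 * q) * A k)).trace ≤
      sigma A ^ 4 * (X ^ (2 * q)).trace := by
  have h1 : ∀ k, ∑ l, (A l * A l * (A k * X ^ (2 * q) * A k)).trace ≤
      sigma A ^ 2 * (A k * A k * X ^ (2 * q)).trace := by
    intro k
    have h := trace_mul_mul_transpose_le (∑ l, A l * A l) (A k * X ^ q)
    have e : A k * X ^ q * (A k * X ^ q)ᵀ = A k * X ^ (2 * q) * A k := by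
      rw [transpose_mul, transpose_pow, hX.eq, (hA k).eq, two_mul, pow_add]
      simp only [Matrix.mul_assoc]
    rw [e, ← sigma_sq, Finset.sum_mul, trace_sum] at h
    rwa [trace_mul_comm (A k * X ^ (2 * q)) (A k), ← Matrix.mul_assoc (A k)] at h
  refine (Finset.sum_le_sum fun k _ => h1 k).trans ?_
  rw [← Finset.mul_sum]
  refine (mul_le_mul_of_nonneg_left (sum_trace_sq_mul_pow_le A hX q) (sq_nonneg _)).trans_eq ?_
  ring

theorem sum_trace_crossing_le (A : Fin s → Matrix (Fin n) (Fin n) ℝ)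
    {X : Matrix (Fin n) (Fin n) ℝ} (hX : X.IsSymm) (q i : ℕ) (hi : i < 2 * q) :
    ∑ k, ∑ l, (A l * (X * A k * (X ^ i * A l * X ^ (2 * q - 1 - i)) * A k)).trace ≤
      sigmaTilde A ^ 4 * (X ^ (2 * q)).trace := by
  have h := (le_abs_self _).trans
    (abs_crossTrace_pow_le A hX 1 i (2 * q - 1 - i) 0 q (by omega))
  rw [crossTrace_apply, Finset.sum_comm] at h
  simpa only [pow_one, pow_zero, Matrix.mul_one, Matrix.mul_assoc] using h

theorem gaussExp_trace_sandwich_le {A : Fin s → Matrix (Fin n) (Fin n) ℝ}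
    (hA : ∀ k, (A k).IsSymm) (q : ℕ) :
    ∑ k, gaussExp (constMat (A k) * polySeries A ^ 2 * constMat (A k) *
      polySeries A ^ (2 * q)).trace ≤
      (sigma A ^ 4 + 2 * q * sigmaTilde A ^ 4) * traceMoment A q := by
  have e : ∀ k, gaussExp (constMat (A k) * polySeries A ^ 2 * constMat (A k) *
      polySeries A ^ (2 * q)).trace = gaussExp (∑ l, (constMat (A l) *
        (constMat (A l) * (constMat (A k) * polySeries A ^ (2 * q) * constMat (A k)) +
        ∑ i ∈ Finset.range (2 * q), polySeries A * constMat (A k) *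
          (polySeries A ^ i * constMat (A l) * polySeries A ^ (2 * q - 1 - i)) *
            constMat (A k))).trace) := by
    intro k
    have h : (constMat (A k) * polySeries A ^ 2 * constMat (A k) * polySeries A ^ (2 * q)).trace =
        (polySeries A * (polySeries A *
          (constMat (A k) * polySeries A ^ (2 * q) * constMat (A k)))).trace := by
      rw [Matrix.mul_assoc, Matrix.mul_assoc, trace_mul_comm, pow_two]
      simp only [Matrix.mul_assoc]
    -- Differentiating the leading X gives the nested pairing; differentiating X^(2q) gives 2q
    -- crossing ones.
    have hD : ∀ l, matDeriv l (polySeries A *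
        (constMat (A k) * polySeries A ^ (2 * q) * constMat (A k))) =
        constMat (A l) * (constMat (A k) * polySeries A ^ (2 * q) * constMat (A k)) +
        ∑ i ∈ Finset.range (2 * q), polySeries A * constMat (A k) *
          (polySeries A ^ i * constMat (A l) * polySeries A ^ (2 * q - 1 - i)) *
            constMat (A k) := by
      intro l
      rw [matDeriv_mul, matDeriv_polySeries, matDeriv_mul, matDeriv_mul, matDeriv_constMat,
        matDeriv_pow, Matrix.zero_mul, Matrix.mul_zero, zero_add, add_zero,
        Finset.mul_sum, Finset.sum_mul, Finset.mul_sum]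
      simp only [Matrix.mul_assoc]
    rw [h, gaussExp_trace_polySeries_mul]
    simp only [hD]
  simp only [e]
  rw [← map_sum, traceMoment, ← smul_eq_mul (sigma A ^ 4 + _), ← map_smul]
  refine gaussExp_mono fun x => ?_
  have hX := isSymm_series hA x
  simp only [map_sum, eval_trace, map_mul, map_add, map_pow, evalMat_constMat, evalMat_polySeries,
    MvPolynomial.smul_eval]
  have h1 := sum_trace_nested_le hA hX q
  have h2 := Finset.sum_le_sum fun i (hi : i ∈ Finset.range (2 * q)) =>
    sum_trace_crossing_le A hX q i (Finset.mem_range.1 hi)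
  rw [Finset.sum_const, Finset.card_range, nsmul_eq_mul, Finset.sum_comm] at h2
  simp only [fun k => Finset.sum_comm (s := Finset.range (2 * q)) (t := Finset.univ (α := Fin s))
    (f := fun i l => (A l * (series A x * A k * (series A x ^ i * A l *
      series A x ^ (2 * q - 1 - i)) * A k)).trace)] at h2
  simp only [Matrix.mul_add, Finset.mul_sum, trace_add, trace_sum, Finset.sum_add_distrib]
  simp only [← Matrix.mul_assoc] at h1 h2 ⊢
  push_cast at h2
  linarith

theorem traceMoment_zero (A : Fin s → Matrix (Fin n) (Fin n) ℝ) : traceMoment A 0 = n := by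
  simp [traceMoment, gaussExp_apply]

theorem traceMoment_one_le {A : Fin s → Matrix (Fin n) (Fin n) ℝ} (hA : ∀ k, (A k).IsSymm) :
    traceMoment A 1 ≤ sigma A ^ 2 * n := by
  rw [traceMoment, mul_one, pow_two, gaussExp_trace_polySeries_mul, ← traceMoment_zero A,
    traceMoment, ← smul_eq_mul (sigma A ^ 2), ← map_smul]
  refine gaussExp_mono fun x => ?_
  have h := sum_trace_sq_mul_pow_le A (isSymm_series hA x) 0
  simp only [matDeriv_polySeries, map_sum, eval_trace, map_mul, evalMat_constMat,
    MvPolynomial.smul_eval, map_pow, evalMat_polySeries]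
  simpa using h

theorem traceMoment_add_two_le {A : Fin s → Matrix (Fin n) (Fin n) ℝ} (hA : ∀ k, (A k).IsSymm)
    (q : ℕ) :
    traceMoment A (q + 2) ≤ 4 * sigma A ^ 2 * traceMoment A (q + 1) +
      (2 * (q + 1) + 1) * (sigma A ^ 4 + 2 * q * sigmaTilde A ^ 4) * traceMoment A q := by
  have h0 : traceMoment A (q + 2) = gaussExp (∑ k, ∑ l ∈ Finset.range (2 * (q + 1) + 1),
      (constMat (A k) * polySeries A ^ l * constMat (A k) *
        polySeries A ^ (2 * (q + 1) - l)).trace) := by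
    rw [traceMoment, show 2 * (q + 2) = 2 * (q + 1) + 1 + 1 by ring, pow_succ',
      gaussExp_trace_polySeries_mul]
    congr 1
    refine Finset.sum_congr rfl fun k _ => ?_
    rw [matDeriv_pow, Finset.mul_sum, trace_sum]
    simp only [Matrix.mul_assoc, Nat.add_sub_cancel]
  have h1 : traceMoment A (q + 2) ≤ gaussExp (∑ k, ((4 : ℝ) • (constMat (A k) * constMat (A k) *
      polySeries A ^ (2 * (q + 1))).trace + (2 * (q + 1) + 1 : ℝ) •
        (constMat (A k) * polySeries A ^ 2 * constMat (A k) * polySeries A ^ (2 * q)).trace)) := by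
    rw [h0]
    refine gaussExp_mono fun x => ?_
    simp only [map_sum, eval_trace, map_mul, map_add, map_pow, evalMat_constMat,
      evalMat_polySeries, MvPolynomial.smul_eval]
    exact Finset.sum_le_sum fun k _ => sum_trace_mul_pow_le (hA k) (isSymm_series hA x) q
  have h2 : gaussExp (∑ k, (constMat (A k) * constMat (A k) *
      polySeries A ^ (2 * (q + 1))).trace) ≤ sigma A ^ 2 * traceMoment A (q + 1) := by
    rw [traceMoment, ← smul_eq_mul (sigma A ^ 2), ← map_smul]
    refine gaussExp_mono fun x => ?_
    simp only [map_sum, eval_trace, map_mul, map_pow, evalMat_constMat,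
      evalMat_polySeries, MvPolynomial.smul_eval]
    exact sum_trace_sq_mul_pow_le A (isSymm_series hA x) (q + 1)
  have h3 := mul_le_mul_of_nonneg_left (gaussExp_trace_sandwich_le hA q)
    (show (0 : ℝ) ≤ 2 * (q + 1) + 1 by positivity)
  rw [map_sum] at h2
  simp only [map_sum, map_add, map_smul, smul_eq_mul, Finset.sum_add_distrib,
    ← Finset.mul_sum] at h1
  linarith

theorem traceMoment_nonneg {A : Fin s → Matrix (Fin n) (Fin n) ℝ} (hA : ∀ k, (A k).IsSymm)
    (p : ℕ) : 0 ≤ traceMoment A p := by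
  refine integral_nonneg fun x => ?_
  simp only [eval_trace, map_pow, evalMat_polySeries]
  exact trace_pow_even_nonneg (isSymm_series hA x) p

/-- Bounding the recursion coefficients uniformly for p ≤ P leaves a constant-coefficient recursion;
`hK2` says that K^p is a supersolution. -/
theorem traceMoment_le {A : Fin s → Matrix (Fin n) (Fin n) ℝ} (hA : ∀ k, (A k).IsSymm)
    (P : ℕ) (K : ℝ) (hK : 4 * sigma A ^ 2 ≤ K)
    (hK2 : 4 * sigma A ^ 2 * K + 2 * P * (sigma A ^ 4 + 2 * P * sigmaTilde A ^ 4) ≤ K ^ 2)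
    (p : ℕ) (hp : p ≤ P) : traceMoment A p ≤ n * K ^ p := by
  have hK0 : 0 ≤ K := (by positivity : 0 ≤ 4 * sigma A ^ 2).trans hK
  induction p using Nat.strong_induction_on with
  | _ p ih =>
    match p with
    | 0 => simp [traceMoment_zero]
    | 1 =>
      rw [pow_one, mul_comm]
      refine (traceMoment_one_le hA).trans (mul_le_mul_of_nonneg_right ?_ (Nat.cast_nonneg n))
      linarith [sq_nonneg (sigma A)]
    | q + 2 =>
      have i1 := ih (q + 1) (by omega) (by omega)
      have i0 := ih q (by omega) (by omega)
      have hqP : (q : ℝ) + 2 ≤ P := by exact_mod_cast hp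
      have hD : (2 * (q + 1) + 1) * (sigma A ^ 4 + 2 * q * sigmaTilde A ^ 4) ≤
          2 * P * (sigma A ^ 4 + 2 * P * sigmaTilde A ^ 4) := by
        have : 0 ≤ sigmaTilde A ^ 4 := by positivity
        have : 0 ≤ sigma A ^ 4 := by positivity
        gcongr <;> linarith
      calc traceMoment A (q + 2) ≤ _ := traceMoment_add_two_le hA q
        _ ≤ 4 * sigma A ^ 2 * (n * K ^ (q + 1)) +
            2 * P * (sigma A ^ 4 + 2 * P * sigmaTilde A ^ 4) * (n * K ^ q) := by
          refine add_le_add (mul_le_mul_of_nonneg_left i1 (by positivity))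
            (mul_le_mul hD i0 (traceMoment_nonneg hA q) (by positivity))
        _ = n * K ^ q * (4 * sigma A ^ 2 * K +
            2 * P * (sigma A ^ 4 + 2 * P * sigmaTilde A ^ 4)) := by ring
        _ ≤ n * K ^ q * K ^ 2 := mul_le_mul_of_nonneg_left hK2 (by positivity)
        _ = n * K ^ (q + 2) := by ring

end Recursion

end StructuredRandomMatrix

/-! ### From trace moments to the expected norm. -/

namespace StructuredRandomMatrix

open Matrix

variable {n s : ℕ}

theorem norm_pow_even_le_trace [NeZero n] {X : Matrix (Fin n) (Fin n) ℝ} (hX : X.IsSymm) (p : ℕ) :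
    ‖X‖ ^ (2 * p) ≤ (X ^ (2 * p)).trace := by
  obtain ⟨V, lam, hV, rfl⟩ := exists_eq_conjDiag hX
  have hV' := mul_eq_one_comm.1 hV
  have hU : V ∈ unitaryGroup (Fin n) ℝ := by
    rw [mem_unitaryGroup_iff', star_eq_conjTranspose, conjTranspose_eq_transpose_of_trivial, hV]
  have hU' : Vᵀ ∈ unitaryGroup (Fin n) ℝ := by
    rw [mem_unitaryGroup_iff', star_eq_conjTranspose, conjTranspose_eq_transpose_of_trivial,
      transpose_transpose, hV']
  obtain ⟨j, -, hj⟩ := Finset.univ.exists_max_image (fun j => ‖lam j‖) Finset.univ_nonempty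
  have hnorm : ‖conjDiag V lam‖ ≤ ‖lam j‖ := by
    rw [conjDiag_apply, CStarRing.norm_mul_mem_unitary _ hU', CStarRing.norm_mem_unitary_mul _ hU,
      l2_opNorm_diagonal]
    exact (pi_norm_le_iff_of_nonneg (norm_nonneg _)).2 fun i => hj i (Finset.mem_univ i)
  rw [conjDiag_pow hV, trace_conjDiag hV]
  refine (pow_le_pow_left₀ (norm_nonneg _) hnorm _).trans ?_
  rw [Real.norm_eq_abs, (even_two_mul p).pow_abs]
  exact Finset.single_le_sum (f := fun i => lam i ^ (2 * p))
    (fun i _ => (even_two_mul p).pow_nonneg _) (Finset.mem_univ j)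

theorem continuous_norm_series (A : Fin s → Matrix (Fin n) (Fin n) ℝ) :
    Continuous fun x => ‖series A x‖ := by
  unfold series
  fun_prop

theorem integrable_norm_series_pow [NeZero n] {A : Fin s → Matrix (Fin n) (Fin n) ℝ}
    (hA : ∀ k, (A k).IsSymm) (p : ℕ) :
    Integrable (fun x => ‖series A x‖ ^ (2 * p)) (stdGauss s) := by
  refine (integrable_eval_stdGauss (polySeries A ^ (2 * p)).trace).mono'
    ((continuous_norm_series A).pow _).aestronglyMeasurable (.of_forall fun x => ?_)
  rw [eval_trace, map_pow, evalMat_polySeries, Real.norm_of_nonneg (by positivity)]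
  exact norm_pow_even_le_trace (isSymm_series hA x) p

theorem integrable_norm_series [NeZero n] {A : Fin s → Matrix (Fin n) (Fin n) ℝ}
    (hA : ∀ k, (A k).IsSymm) : Integrable (fun x => ‖series A x‖) (stdGauss s) := by
  refine ((integrable_const (1 : ℝ)).add (integrable_norm_series_pow hA 1)).mono'
    (continuous_norm_series A).aestronglyMeasurable (.of_forall fun x => ?_)
  rw [norm_norm, Pi.add_apply, mul_one]
  nlinarith [sq_nonneg (‖series A x‖ - 1), norm_nonneg (series A x)]

theorem integral_norm_series_pow_le [NeZero n] {A : Fin s → Matrix (Fin n) (Fin n) ℝ}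
    (hA : ∀ k, (A k).IsSymm) (p : ℕ) :
    (∫ x, ‖series A x‖ ∂(stdGauss s)) ^ (2 * p) ≤ traceMoment A p := by
  refine ((convexOn_pow (2 * p)).map_integral_le (μ := stdGauss s)
    (continuous_pow _).continuousOn isClosed_Ici (.of_forall fun x => norm_nonneg _)
    (integrable_norm_series hA) (integrable_norm_series_pow hA p)).trans ?_
  refine integral_mono (integrable_norm_series_pow hA p) (integrable_eval_stdGauss _) fun x => ?_
  simp only [eval_trace, map_pow, evalMat_polySeries]
  exact norm_pow_even_le_trace (isSymm_series hA x) p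

theorem sq_integral_norm_series_le [NeZero n] {A : Fin s → Matrix (Fin n) (Fin n) ℝ}
    (hA : ∀ k, (A k).IsSymm) {P : ℕ} (hP : P ≠ 0) (hn : (n : ℝ) ≤ Real.exp P) :
    (∫ x, ‖series A x‖ ∂(stdGauss s)) ^ 2 ≤ Real.exp 1 * (4 * sigma A ^ 2 +
      √(2 * P * (sigma A ^ 4 + 2 * P * sigmaTilde A ^ 4))) := by
  set D := 2 * P * (sigma A ^ 4 + 2 * P * sigmaTilde A ^ 4) with hD
  have hD0 : 0 ≤ D := by positivity
  -- This K satisfies K(K - 4σ²) = K√D ≥ D, which is the condition `hK2`.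
  set K := 4 * sigma A ^ 2 + √D with hK
  have hs : 0 ≤ 4 * sigma A ^ 2 := by positivity
  have hr := Real.sqrt_nonneg D
  have hrr := Real.mul_self_sqrt hD0
  have hK0 : 0 ≤ K := add_nonneg hs hr
  have h := (integral_norm_series_pow_le hA P).trans
    (traceMoment_le hA P K (by linarith) (by rw [← hD, hK]; nlinarith) P le_rfl)
  rw [pow_mul] at h
  refine (pow_le_pow_iff_left₀ (by positivity) (by positivity) hP).1 (h.trans ?_)
  rw [mul_pow, ← Real.exp_nat_mul, mul_one]
  exact mul_le_mul_of_nonneg_right hn (by positivity)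

theorem integral_norm_series_le {A : Fin s → Matrix (Fin n) (Fin n) ℝ}
    (hA : ∀ k, (A k).IsSymm) (hn : 2 ≤ n) :
    ∫ x, ‖series A x‖ ∂(stdGauss s) ≤ 6 * (sigma A * Real.log n ^ (1 / 4 : ℝ) +
      sigmaTilde A * Real.log n ^ (1 / 2 : ℝ)) := by
  have : NeZero n := ⟨by omega⟩
  have hn2 : (2 : ℝ) ≤ n := by exact_mod_cast hn
  have hL : 0.69 ≤ Real.log n :=
    (by linarith [Real.log_two_gt_d9] : 0.69 ≤ Real.log 2).trans
      (Real.log_le_log (by norm_num) hn2)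
  have hL0 : 0 ≤ Real.log n := by linarith
  set a := Real.log n ^ (1 / 4 : ℝ) with ha
  have ha0 : 0 ≤ a := by positivity
  have ha4 : a ^ 4 = Real.log n := by
    rw [ha, ← Real.rpow_natCast, ← Real.rpow_mul hL0]; norm_num
  have ha2 : Real.log n ^ (1 / 2 : ℝ) = a ^ 2 := by
    rw [ha, ← Real.rpow_natCast, ← Real.rpow_mul hL0]; norm_num
  set P := ⌈Real.log n⌉₊ with hPdef
  have hP0 : P ≠ 0 := (Nat.ceil_pos.2 (by linarith)).ne'
  -- Since log n ≥ 0.69, rounding up costs at most 1 ≤ (3/2) log n.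
  have hP1 : (P : ℝ) ≤ 5 / 2 * a ^ 4 := by
    have := Nat.ceil_lt_add_one hL0
    rw [← hPdef] at this
    rw [ha4]; linarith
  have hexp : (n : ℝ) ≤ Real.exp P := by
    rw [← Real.exp_log (show (0 : ℝ) < n by linarith)]
    exact Real.exp_le_exp.2 (Nat.le_ceil _)
  have h := sq_integral_norm_series_le hA hP0 hexp
  have hs := sigma_nonneg A
  have ht := sigmaTilde_nonneg A
  have hD : √(2 * P * (sigma A ^ 4 + 2 * P * sigmaTilde A ^ 4)) ≤
      5 * a ^ 2 * sigma A ^ 2 + 5 * a ^ 4 * sigmaTilde A ^ 2 := by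
    refine Real.sqrt_le_iff.2 ⟨by positivity, ?_⟩
    calc 2 * P * (sigma A ^ 4 + 2 * P * sigmaTilde A ^ 4)
        ≤ 2 * (5 / 2 * a ^ 4) * (sigma A ^ 4 + 2 * (5 / 2 * a ^ 4) * sigmaTilde A ^ 4) := by gcongr
      _ ≤ 2 * (5 / 2 * a ^ 4) * (sigma A ^ 4 + 2 * (5 / 2 * a ^ 4) * sigmaTilde A ^ 4) +
          (20 * a ^ 4 * sigma A ^ 4 + 50 * a ^ 6 * sigma A ^ 2 * sigmaTilde A ^ 2) :=
        le_add_of_nonneg_right (by positivity)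
      _ = (5 * a ^ 2 * sigma A ^ 2 + 5 * a ^ 4 * sigmaTilde A ^ 2) ^ 2 := by ring
  -- From a⁴ = log n ≥ 0.69 > (4/5)². It lets the term 4σ², which has no logarithm, be absorbed into
  -- 5a²σ².
  have ha2' : 4 / 5 ≤ a ^ 2 := by
    refine le_of_sq_le_sq ?_ (by positivity)
    nlinarith
  rw [ha2]
  refine le_of_sq_le_sq (h.trans ?_) (by positivity)
  have h4 : 4 * sigma A ^ 2 ≤ 5 * a ^ 2 * sigma A ^ 2 :=
    mul_le_mul_of_nonneg_right (by linarith) (sq_nonneg _)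
  calc Real.exp 1 * (4 * sigma A ^ 2 + √(2 * P * (sigma A ^ 4 + 2 * P * sigmaTilde A ^ 4)))
      ≤ 3 * (5 * a ^ 2 * sigma A ^ 2 +
          (5 * a ^ 2 * sigma A ^ 2 + 5 * a ^ 4 * sigmaTilde A ^ 2)) := by
        refine mul_le_mul (by linarith [Real.exp_one_lt_d9]) (add_le_add h4 hD) (by positivity)
          (by norm_num)
    _ ≤ 3 * (5 * a ^ 2 * sigma A ^ 2 +
          (5 * a ^ 2 * sigma A ^ 2 + 5 * a ^ 4 * sigmaTilde A ^ 2)) +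
          (6 * a ^ 2 * sigma A ^ 2 + 21 * a ^ 4 * sigmaTilde A ^ 2 +
            72 * a ^ 3 * sigma A * sigmaTilde A) := le_add_of_nonneg_right (by positivity)
    _ = (6 * (sigma A * a + sigmaTilde A * a ^ 2)) ^ 2 := by ring

end StructuredRandomMatrix

theorem mainTheorem7 :
    ∃ C : ℝ, 0 < C ∧
      ∀ (n s : ℕ), 2 ≤ n →
      ∀ (A : Fin s → Matrix (Fin n) (Fin n) ℝ), (∀ k, (A k).IsSymm) →
      ∀ (Ω : Type*) [MeasurableSpace Ω] (μ : Measure Ω) [IsProbabilityMeasure μ]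
        (g : Fin s → Ω → ℝ), iIndepFun g μ → (∀ k, HasLaw (g k) (gaussianReal 0 1) μ) →
        Integrable (fun ω => ‖StructuredRandomMatrix.gaussianSeries A g ω‖) μ ∧
        ∫ ω, ‖StructuredRandomMatrix.gaussianSeries A g ω‖ ∂μ ≤
          C * (StructuredRandomMatrix.sigma A * Real.log n ^ (1 / 4 : ℝ) +
            StructuredRandomMatrix.sigmaTilde A * Real.log n ^ (1 / 2 : ℝ)) := by
  refine ⟨6, by norm_num, fun n s hn A hA Ω _ μ _ g hg hlaw => ?_⟩
  have : NeZero n := ⟨by omega⟩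
  have hpi : HasLaw (fun ω k => g k ω) (StructuredRandomMatrix.stdGauss s) μ :=
    iIndepFun.hasLaw_pi hlaw hg
  have hcont := StructuredRandomMatrix.continuous_norm_series A
  have hint := StructuredRandomMatrix.integrable_norm_series hA
  constructor
  · rw [← hpi.map_eq] at hint
    exact hint.comp_aemeasurable hpi.aemeasurable
  · refine le_of_eq_of_le ?_ (StructuredRandomMatrix.integral_norm_series_le hA hn)
    exact hpi.integral_comp hcont.aestronglyMeasurable
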